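/- Let $R$ and $S$ be associative rings with unit, and let ${}_R\omega_S$ be a semidualizing bimodule, that is, an $(R,S)$-bimodule such that ${}_R\omega$ and $\omega_S$ both admit projective resolutions by finitely generated projective modules, the homothety maps $R\to\mathrm{Hom}_{S^{op}}(\omega,\omega)$ and $S\to\mathrm{Hom}_R(\omega,\omega)$ are isomorphisms, and $\mathrm{Ext}_R^{i}(\omega,\omega)=0=\mathrm{Ext}_{S^{op}}^{i}(\omega,\omega)$ for all $i\ge 1$. For a left $R$-module $M$, let $0\to M\to I^0\xrightarrow{f^0} I^1$ be the beginning of a minimal injective resolution of $M$ and put $\mathrm{cTr}_\omega M=\mathrm{Coker}\bigl(\mathrm{Hom}_R(\omega,f^0)\bigr)$, a left $S$-module. The module $M$ is called $n$-$\omega$-cotorsionfree if $\mathrm{Tor}_i^S(\omega,\mathrm{cTr}_\omega M)=0$ for $1\le i\le n$, and $\infty$-$\omega$-cotorsionfree if it is $n$-$\omega$-cotorsionfree for all $n$. Let $\mathrm{c}\mathcal{T}(R)$ be the full subcategory of left $R$-modules whose objects are the $\infty$-$\omega$-cotorsionfree modules. A left $S$-module $N$ is called $\omega$-adstatic if the canonical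 homomorphism $\mu_N:N\to\mathrm{Hom}_R(\omega,\omega\otimes_S N)$, $\mu_N(y)(x)=x\otimes y$, is an isomorphism. Put $\omega^+=\mathrm{Hom}_{\mathbb Z}(\omega,\mathbb Q/\mathbb Z)$, a left $S$-module, and let $\mathcal{H}(\omega)$ be the full subcategory of left $S$-modules whose objects are the $\omega$-adstatic modules $N$ with $\mathrm{Ext}_S^{i}(N,\omega^+)=0$ for all $i\ge 1$. Then $\mathrm{Hom}_R(\omega,-)$ maps $\mathrm{c}\mathcal{T}(R)$ into $\mathcal{H}(\omega)$, $\omega\otimes_S-$ maps $\mathcal{H}(\omega)$ into $\mathrm{c}\mathcal{T}(R)$, and the resulting functors $\mathrm{c}\mathcal{T}(R)\rightleftarrows\mathcal{H}(\omega)$ are mutually quasi-inverse equivalences of categories. -/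

import Mathlib

open CategoryTheory MulOpposite
open scoped TensorProduct

universe u

/-! An `(R, S)`-bimodule `ω` is given by `[Module R ω] [Module Sᵐᵒᵖ ω] [SMulCommClass R Sᵐᵒᵖ ω]`;
the right action is `x · s = op s • x`. -/

namespace Semidualizing

noncomputable section

section Homothety

variable {R S ω : Type u} [Ring R] [Ring S] [AddCommGroup ω] [Module R ω] [Module Sᵐᵒᵖ ω]
variable [SMulCommClass R Sᵐᵒᵖ ω]

variable (S ω) in
/-- Left multiplication by `r` on `ω`, a homomorphism of right `S`-modules. -/
def leftHomothety (r : R) : ω →ₗ[Sᵐᵒᵖ] ω where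
  toFun x := r • x
  map_add' := smul_add r
  map_smul' s x := smul_comm r s x

variable (R ω) in
/-- Right multiplication by `s` on `ω`, a homomorphism of left `R`-modules. -/
def rightHomothety (s : S) : ω →ₗ[R] ω where
  toFun x := op s • x
  map_add' := smul_add (op s)
  map_smul' r x := (smul_comm r (op s) x).symm

end Homothety

section Hom

/-- `Hom_R(ω, M)`, with the left `S`-module structure `(s • f) x = f (x · s)` below. -/
def RHom (R ω M : Type u) [Ring R] [AddCommGroup ω] [Module R ω] [AddCommGroup M] [Module R M] :
    Type u := ω →ₗ[R] M

variable {R ω M : Type u} [Ring R] [AddCommGroup ω] [Module R ω] [AddCommGroup M] [Module R M]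

instance : AddCommGroup (RHom R ω M) := inferInstanceAs (AddCommGroup (ω →ₗ[R] M))

instance : FunLike (RHom R ω M) ω M := inferInstanceAs (FunLike (ω →ₗ[R] M) ω M)

@[ext] theorem RHom.ext {f g : RHom R ω M} (h : ∀ x, f x = g x) : f = g := DFunLike.ext _ _ h

variable {S : Type u} [Ring S] [Module Sᵐᵒᵖ ω] [SMulCommClass R Sᵐᵒᵖ ω]

instance : Module S (RHom R ω M) where
  smul s f := LinearMap.comp (f : ω →ₗ[R] M) (rightHomothety R ω s)
  one_smul f := RHom.ext fun x => congrArg f (one_smul Sᵐᵒᵖ x)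
  mul_smul s t f := RHom.ext fun x => congrArg f (mul_smul (op t) (op s) x)
  smul_zero _ := rfl
  smul_add _ _ _ := rfl
  add_smul s t f := RHom.ext fun x =>
    (congrArg f (add_smul (op s) (op t) x)).trans (LinearMap.map_add (f : ω →ₗ[R] M) _ _)
  zero_smul f := RHom.ext fun x =>
    (congrArg f (zero_smul Sᵐᵒᵖ x)).trans (LinearMap.map_zero (f : ω →ₗ[R] M))

theorem RHom.smul_apply (s : S) (f : RHom R ω M) (x : ω) : (s • f) x = f (op s • x) := rfl

/-- Post-composition with `g : M → M'`, as an `S`-linear map `Hom_R(ω, M) → Hom_R(ω, M')`. -/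
def RHom.map (S : Type u) [Ring S] [Module Sᵐᵒᵖ ω] [SMulCommClass R Sᵐᵒᵖ ω]
    {M' : Type u} [AddCommGroup M'] [Module R M'] (g : M →ₗ[R] M') :
    RHom R ω M →ₗ[S] RHom R ω M' where
  toFun f := g.comp (f : ω →ₗ[R] M)
  map_add' f f' := LinearMap.comp_add (f : ω →ₗ[R] M) (f' : ω →ₗ[R] M) g
  map_smul' _ _ := rfl

end Hom

section Tensor

variable (R S ω : Type u) [Ring R] [Ring S] [AddCommGroup ω] [Module R ω] [Module Sᵐᵒᵖ ω]
variable (N : Type u) [AddCommGroup N] [Module S N]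

/-- The `R`-submodule of `ω ⊗_ℤ N` generated by the elements `(x · s) ⊗ y - x ⊗ (s • y)`. When `ω`
is a bimodule, multiplying such an element by `r : R` gives another one, so this is also the
subgroup generated by them. -/
def balancing : Submodule R (ω ⊗[ℤ] N) :=
  Submodule.span R {t | ∃ (x : ω) (s : S) (y : N), t = (op s • x) ⊗ₜ[ℤ] y - x ⊗ₜ[ℤ] (s • y)}

/-- The tensor product `ω ⊗_S N`, a left `R`-module through `r • (x ⊗ y) = (r • x) ⊗ y`. -/
def Tens : Type u := (ω ⊗[ℤ] N) ⧸ balancing R S ω N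

instance : AddCommGroup (Tens R S ω N) :=
  inferInstanceAs (AddCommGroup ((ω ⊗[ℤ] N) ⧸ balancing R S ω N))

instance : Module R (Tens R S ω N) :=
  inferInstanceAs (Module R ((ω ⊗[ℤ] N) ⧸ balancing R S ω N))

variable {N}

/-- The elementary tensor `x ⊗ y` in `ω ⊗_S N`. -/
def Tens.tmul (x : ω) (y : N) : Tens R S ω N :=
  (balancing R S ω N).mkQ (x ⊗ₜ[ℤ] y)

theorem Tens.tmul_add (x : ω) (y y' : N) :
    Tens.tmul R S ω x (y + y') = Tens.tmul R S ω x y + Tens.tmul R S ω x y' := by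
  unfold Tens.tmul
  rw [TensorProduct.tmul_add]
  exact map_add _ _ _

theorem Tens.add_tmul (x x' : ω) (y : N) :
    Tens.tmul R S ω (x + x') y = Tens.tmul R S ω x y + Tens.tmul R S ω x' y := by
  unfold Tens.tmul
  rw [TensorProduct.add_tmul]
  exact map_add _ _ _

theorem Tens.smul_tmul (r : R) (x : ω) (y : N) :
    Tens.tmul R S ω (r • x) y = r • Tens.tmul R S ω x y := rfl

theorem Tens.op_smul_tmul (s : S) (x : ω) (y : N) :
    Tens.tmul R S ω (op s • x) y = Tens.tmul R S ω x (s • y) :=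
  (Submodule.Quotient.eq _).2 (Submodule.subset_span ⟨x, s, y, rfl⟩)

/-- The homomorphism `ω ⊗_S N → ω ⊗_S N'`, `x ⊗ y ↦ x ⊗ g y`. -/
def Tens.map {N' : Type u} [AddCommGroup N'] [Module S N'] (g : N →ₗ[S] N') :
    Tens R S ω N →ₗ[R] Tens R S ω N' :=
  Submodule.mapQ (balancing R S ω N) (balancing R S ω N')
    (TensorProduct.AlgebraTensorModule.map (LinearMap.id : ω →ₗ[R] ω) (g.restrictScalars ℤ)) <| by
      refine Submodule.span_le.2 ?_
      rintro _ ⟨x, s, y, rfl⟩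
      refine Submodule.subset_span ⟨x, s, g y, ?_⟩
      simp

theorem Tens.map_tmul {N' : Type u} [AddCommGroup N'] [Module S N'] (g : N →ₗ[S] N')
    (x : ω) (y : N) : Tens.map R S ω g (Tens.tmul R S ω x y) = Tens.tmul R S ω x (g y) := rfl

theorem Tens.hom_ext {P : Type u} [AddCommGroup P] [Module R P] {f g : Tens R S ω N →ₗ[R] P}
    (h : ∀ x y, f (Tens.tmul R S ω x y) = g (Tens.tmul R S ω x y)) : f = g := by
  refine LinearMap.ext fun t => ?_
  obtain ⟨t, rfl⟩ := (balancing R S ω N).mkQ_surjective t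
  induction t using TensorProduct.induction_on with
  | zero => exact (map_zero f).trans (map_zero g).symm
  | tmul x y => exact h x y
  | add a b ha hb =>
    rw [map_add]
    exact (map_add f _ _).trans ((congrArg₂ (· + ·) ha hb).trans (map_add g _ _).symm)

end Tensor

section Functors

variable (R S ω : Type u) [Ring R] [Ring S] [AddCommGroup ω] [Module R ω] [Module Sᵐᵒᵖ ω]

/-- The functor `Hom_R(ω, -)` from left `R`-modules to left `S`-modules. -/
def homFunctor [SMulCommClass R Sᵐᵒᵖ ω] : ModuleCat.{u} R ⥤ ModuleCat.{u} S where
  obj M := ModuleCat.of S (RHom R ω M)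
  map g := ModuleCat.ofHom (RHom.map S g.hom)

/-- The functor `ω ⊗_S -` from left `S`-modules to left `R`-modules. -/
def tensorFunctor : ModuleCat.{u} S ⥤ ModuleCat.{u} R where
  obj N := ModuleCat.of R (Tens R S ω N)
  map g := ModuleCat.ofHom (Tens.map R S ω g.hom)
  map_id _ := ModuleCat.hom_ext (Tens.hom_ext R S ω fun _ _ => rfl)
  map_comp _ _ := ModuleCat.hom_ext (Tens.hom_ext R S ω fun _ _ => rfl)

instance : (tensorFunctor R S ω).Additive where
  map_add := ModuleCat.hom_ext (Tens.hom_ext R S ω fun x _ => Tens.tmul_add R S ω x _ _)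

/-- `Tor_i^S(ω, N)`, the value at `N` of the `i`-th left derived functor of `ω ⊗_S -`. -/
def Tor (i : ℕ) (N : ModuleCat.{u} S) : ModuleCat.{u} R :=
  ((tensorFunctor R S ω).leftDerived i).obj N

end Functors

section Dual

/-- `ω⁺ = Hom_ℤ(ω, ℚ/ℤ)`, with the left `S`-module structure `(s • f) x = f (x · s)` below. -/
def CharDual (ω : Type u) [AddCommGroup ω] : Type u := ω →+ AddCircle (1 : ℚ)

variable {S ω : Type u} [Ring S] [AddCommGroup ω] [Module Sᵐᵒᵖ ω]

instance : AddCommGroup (CharDual ω) := inferInstanceAs (AddCommGroup (ω →+ AddCircle (1 : ℚ)))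

instance : FunLike (CharDual ω) ω (AddCircle (1 : ℚ)) :=
  inferInstanceAs (FunLike (ω →+ AddCircle (1 : ℚ)) ω (AddCircle (1 : ℚ)))

@[ext] theorem CharDual.ext {f g : CharDual ω} (h : ∀ x, f x = g x) : f = g := DFunLike.ext _ _ h

instance : Module S (CharDual ω) where
  smul s f := AddMonoidHom.comp (f : ω →+ AddCircle (1 : ℚ)) (DistribSMul.toAddMonoidHom ω (op s))
  one_smul f := CharDual.ext fun x => congrArg f (one_smul Sᵐᵒᵖ x)
  mul_smul s t f := CharDual.ext fun x => congrArg f (mul_smul (op t) (op s) x)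
  smul_zero _ := rfl
  smul_add _ _ _ := rfl
  add_smul s t f := CharDual.ext fun x =>
    (congrArg f (add_smul (op s) (op t) x)).trans
      (AddMonoidHom.map_add (f : ω →+ AddCircle (1 : ℚ)) _ _)
  zero_smul f := CharDual.ext fun x =>
    (congrArg f (zero_smul Sᵐᵒᵖ x)).trans (AddMonoidHom.map_zero (f : ω →+ AddCircle (1 : ℚ)))

theorem CharDual.smul_apply (s : S) (f : CharDual ω) (x : ω) : (s • f) x = f (op s • x) := rfl

end Dual

section Classes

variable (R S ω : Type u) [Ring R] [Ring S] [AddCommGroup ω] [Module R ω] [Module Sᵐᵒᵖ ω]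

/-- The `A`-module `X` has a projective resolution by finitely generated projective modules. -/
def HasDegreewiseFiniteResolution (A X : Type u) [Ring A] [AddCommGroup X] [Module A X] : Prop :=
  ∃ P : ProjectiveResolution (ModuleCat.of A X), ∀ n, Module.Finite A (P.complex.X n)

/-- The bimodule `ω` is semidualizing. Right `S`-modules are left `Sᵐᵒᵖ`-modules. -/
structure IsSemidualizing [SMulCommClass R Sᵐᵒᵖ ω] : Prop where
  finite_left : HasDegreewiseFiniteResolution R ω
  finite_right : HasDegreewiseFiniteResolution Sᵐᵒᵖ ω
  /-- The homothety map `R → Hom_{Sᵒᵖ}(ω, ω)`, `r ↦ (x ↦ r • x)`, is an isomorphism. -/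
  homothety_left : Function.Bijective fun r : R => leftHomothety S ω r
  /-- The homothety map `S → Hom_R(ω, ω)`, `s ↦ (x ↦ x · s)`, is an isomorphism. -/
  homothety_right : Function.Bijective fun s : S => rightHomothety R ω s
  ext_left : ∀ i : ℕ, 1 ≤ i →
    Subsingleton (Abelian.Ext (ModuleCat.of R ω) (ModuleCat.of R ω) i)
  ext_right : ∀ i : ℕ, 1 ≤ i →
    Subsingleton (Abelian.Ext (ModuleCat.of Sᵐᵒᵖ ω) (ModuleCat.of Sᵐᵒᵖ ω) i)

/-- A submodule is essential if it meets every nonzero submodule nontrivially. -/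
def IsEssential {A X : Type u} [Ring A] [AddCommGroup X] [Module A X] (E : Submodule A X) : Prop :=
  ∀ K : Submodule A X, K ⊓ E = ⊥ → K = ⊥

variable {R} in
/-- The beginning `0 → M → I⁰ → I¹` of a minimal injective resolution of `M`: an exact sequence
in which `M → I⁰` is an injective envelope of `M` and the inclusion of the image of `I⁰ → I¹`
is an injective envelope of that image. -/
structure MinimalInjectiveCopresentation (M : ModuleCat.{u} R) where
  I₀ : ModuleCat.{u} R
  I₁ : ModuleCat.{u} R
  ε : M ⟶ I₀
  f : I₀ ⟶ I₁
  injective₀ : Injective I₀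
  injective₁ : Injective I₁
  ε_injective : Function.Injective ε
  exact : Function.Exact ε f
  essential₀ : IsEssential (LinearMap.range ε.hom)
  essential₁ : IsEssential (LinearMap.range f.hom)

variable {R} in
/-- The cotranspose `cTr_ω M`, the cokernel of `Hom_R(ω, I⁰) → Hom_R(ω, I¹)`, computed from the
minimal injective copresentation `P` of `M` (which is unique up to isomorphism). -/
def cotranspose [SMulCommClass R Sᵐᵒᵖ ω] {M : ModuleCat.{u} R}
    (P : MinimalInjectiveCopresentation M) : ModuleCat.{u} S :=
  ModuleCat.of S (RHom R ω P.I₁ ⧸ LinearMap.range (RHom.map (ω := ω) S P.f.hom))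

variable {R} in
/-- `M` is `n`-`ω`-cotorsionfree: `Tor_i^S(ω, cTr_ω M) = 0` for `1 ≤ i ≤ n`. -/
def IsCotorsionfree [SMulCommClass R Sᵐᵒᵖ ω] (n : ℕ) (M : ModuleCat.{u} R) : Prop :=
  ∃ P : MinimalInjectiveCopresentation M,
    ∀ i : ℕ, 1 ≤ i → i ≤ n → Limits.IsZero (Tor R S ω i (cotranspose S ω P))

/-- The class `cT(R)` of `∞`-`ω`-cotorsionfree left `R`-modules. -/
def cT [SMulCommClass R Sᵐᵒᵖ ω] : ObjectProperty (ModuleCat.{u} R) :=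
  fun M => ∀ n : ℕ, IsCotorsionfree S ω n M

/-- The canonical homomorphism `μ_N : N → Hom_R(ω, ω ⊗_S N)`, `μ_N(y)(x) = x ⊗ y`. -/
def μ [SMulCommClass R Sᵐᵒᵖ ω] (N : Type u) [AddCommGroup N] [Module S N] :
    N →ₗ[S] RHom R ω (Tens R S ω N) where
  toFun y :=
    ({ toFun := fun x => Tens.tmul R S ω x y
       map_add' := fun x x' => Tens.add_tmul R S ω x x' y
       map_smul' := fun r x => Tens.smul_tmul R S ω r x y } : ω →ₗ[R] Tens R S ω N)
  map_add' y y' := RHom.ext fun x => Tens.tmul_add R S ω x y y'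
  map_smul' s y := RHom.ext fun x => (Tens.op_smul_tmul R S ω s x y).symm

/-- `N` is `ω`-adstatic if `μ_N` is an isomorphism. -/
def IsAdstatic [SMulCommClass R Sᵐᵒᵖ ω] (N : ModuleCat.{u} S) : Prop :=
  Function.Bijective (μ R S ω N)

/-- The class `H(ω)` of `ω`-adstatic left `S`-modules `N` with `Ext_S^i(N, ω⁺) = 0` for `i ≥ 1`. -/
def H [SMulCommClass R Sᵐᵒᵖ ω] : ObjectProperty (ModuleCat.{u} S) :=
  fun N => IsAdstatic R S ω N ∧
    ∀ i : ℕ, 1 ≤ i → Subsingleton (Abelian.Ext N (ModuleCat.of S (CharDual ω)) i)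

end Classes

end

end Semidualizing

/-!
Write `X⁺` for the character module of `X`. The isomorphism `(ω ⊗_S N)⁺ ≃ Hom_S(N, ω⁺)` turns
statements about `ω ⊗_S -` and `Tor^S(ω, -)` into statements about `Hom_S(-, ω⁺)` and
`Ext_S(-, ω⁺)`. For `R`-injective `I`, tensor evaluation along a resolution of `ω` by finitely
generated projective right modules, together with `Ext_{Sᵒᵖ}^{≥ 1}(ω, ω) = 0` and
`R ≅ Hom_{Sᵒᵖ}(ω, ω)`, shows that the counit `θ_I : ω ⊗_S Hom_R(ω, I) → I` is bijective and that
`Ext_S^{≥ 1}(Hom_R(ω, I), ω⁺) = 0`. Splitting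
`0 → Hom_R(ω, M) → Hom_R(ω, I⁰) → Hom_R(ω, I¹) → cTr_ω M → 0` into short exact sequences and
shifting dimensions, `M` is `∞`-`ω`-cotorsionfree if and only if `θ_M` is bijective and
`Ext_S^{≥ 1}(Hom_R(ω, M), ω⁺) = 0`. The equivalence is thus the restriction of the
tensor-Hom adjunction to the objects with invertible unit or counit and vanishing Ext.
-/

namespace Semidualizing

noncomputable section

section ExtVanishing

open Abelian

variable {C : Type*} [Category C] [Abelian C] [HasExt C] {T : ShortComplex C} {Y : C} {n : ℕ}

/-- `Ext^i(X, Y) = 0` for `1 ≤ i ≤ n`. -/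
def ExtVanishesUpTo (n : ℕ) (X Y : C) : Prop :=
  ∀ i : ℕ, 1 ≤ i → i ≤ n → Subsingleton (Ext X Y i)

theorem subsingleton_ext_of_iso {X X' : C} (e : X ≅ X') (h : Subsingleton (Ext X' Y n)) :
    Subsingleton (Ext X Y n) := by
  refine subsingleton_of_forall_eq 0 fun x => ?_
  rw [← Ext.mk₀_id_comp x, ← e.hom_inv_id, ← Ext.mk₀_comp_mk₀_assoc,
    Subsingleton.elim ((Ext.mk₀ e.inv).comp x (zero_add n)) 0, Ext.comp_zero]

theorem subsingleton_ext_X₁ (hT : T.ShortExact) (h₂ : Subsingleton (Ext T.X₂ Y n))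
    (h₃ : Subsingleton (Ext T.X₃ Y (n + 1))) : Subsingleton (Ext T.X₁ Y n) := by
  refine subsingleton_of_forall_eq 0 fun x => ?_
  obtain ⟨y, rfl⟩ := Ext.contravariant_sequence_exact₁ hT Y x (add_comm 1 n) (Subsingleton.elim _ _)
  rw [Subsingleton.elim y 0, Ext.comp_zero]

theorem subsingleton_ext_X₃ (hT : T.ShortExact) (h₁ : Subsingleton (Ext T.X₁ Y n))
    (h₂ : Subsingleton (Ext T.X₂ Y (n + 1))) : Subsingleton (Ext T.X₃ Y (n + 1)) := by
  refine subsingleton_of_forall_eq 0 fun x => ?_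
  obtain ⟨y, rfl⟩ := Ext.contravariant_sequence_exact₃ hT Y x (Subsingleton.elim _ _) (add_comm 1 n)
  rw [Subsingleton.elim y 0, Ext.comp_zero]

theorem exists_extension_of_subsingleton_ext (hT : T.ShortExact)
    (h₃ : Subsingleton (Ext T.X₃ Y 1)) (φ : T.X₁ ⟶ Y) : ∃ ψ : T.X₂ ⟶ Y, T.f ≫ ψ = φ := by
  obtain ⟨x, hx⟩ := Ext.contravariant_sequence_exact₁ hT Y (Ext.mk₀ φ) rfl (Subsingleton.elim _ _)
  obtain ⟨ψ, rfl⟩ := (Ext.mk₀_bijective _ _).2 x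
  exact ⟨ψ, (Ext.mk₀_bijective _ _).1 (by rw [← hx, Ext.mk₀_comp_mk₀])⟩

theorem subsingleton_ext_one_of_exists_extension (hT : T.ShortExact)
    (h₂ : Subsingleton (Ext T.X₂ Y 1)) (h : ∀ φ : T.X₁ ⟶ Y, ∃ ψ : T.X₂ ⟶ Y, T.f ≫ ψ = φ) :
    Subsingleton (Ext T.X₃ Y 1) := by
  refine subsingleton_of_forall_eq 0 fun x => ?_
  obtain ⟨y, rfl⟩ := Ext.contravariant_sequence_exact₃ hT Y x (Subsingleton.elim _ _)
    (add_comm 1 0)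
  obtain ⟨φ, rfl⟩ := (Ext.mk₀_bijective _ _).2 y
  obtain ⟨ψ, rfl⟩ := h φ
  rw [← Ext.mk₀_comp_mk₀]
  exact hT.extClass_comp_assoc _

theorem extVanishesUpTo_succ_iff (hT : T.ShortExact) (h₂ : ExtVanishesUpTo (n + 1) T.X₂ Y) :
    ExtVanishesUpTo (n + 1) T.X₃ Y ↔
      (∀ φ : T.X₁ ⟶ Y, ∃ ψ : T.X₂ ⟶ Y, T.f ≫ ψ = φ) ∧ ExtVanishesUpTo n T.X₁ Y := by
  constructor
  · exact fun h => ⟨exists_extension_of_subsingleton_ext hT (h 1 le_rfl (by omega)),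
      fun i hi hin => subsingleton_ext_X₁ hT (h₂ i hi (by omega)) (h (i + 1) (by omega) (by omega))⟩
  · rintro ⟨hext, h₁⟩ (_ | _ | i) hi hin
    · omega
    · exact subsingleton_ext_one_of_exists_extension hT (h₂ 1 le_rfl hin) hext
    · exact subsingleton_ext_X₃ hT (h₁ (i + 1) (by omega) (by omega)) (h₂ (i + 2) hi hin)

theorem subsingleton_ext_one_of_exists_lift (hT : T.ShortExact) [Injective T.X₂]
    (h : ∀ φ : Y ⟶ T.X₃, ∃ ψ : Y ⟶ T.X₂, ψ ≫ T.g = φ) : Subsingleton (Ext Y T.X₁ 1) := by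
  refine subsingleton_of_forall_eq 0 fun x => ?_
  obtain ⟨y, rfl⟩ := Ext.covariant_sequence_exact₁ Y hT x (Ext.eq_zero_of_injective _) (zero_add 1)
  obtain ⟨φ, rfl⟩ := (Ext.mk₀_bijective _ _).2 y
  obtain ⟨ψ, rfl⟩ := h φ
  rw [← Ext.mk₀_comp_mk₀, Ext.comp_assoc_of_second_deg_zero, hT.comp_extClass, Ext.comp_zero]

theorem subsingleton_ext_X₁_of_injective (hT : T.ShortExact) [Injective T.X₂]
    (h₃ : Subsingleton (Ext Y T.X₃ n)) : Subsingleton (Ext Y T.X₁ (n + 1)) := by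
  refine subsingleton_of_forall_eq 0 fun x => ?_
  obtain ⟨y, rfl⟩ := Ext.covariant_sequence_exact₁ Y hT x (Ext.eq_zero_of_injective _) rfl
  rw [Subsingleton.elim y 0, Ext.zero_comp]

end ExtVanishing

section Exactness

universe v

variable {A : Type*} [Ring A] {X Y Z X' Y' Z' : Type*}
  [AddCommGroup X] [AddCommGroup Y] [AddCommGroup Z] [Module A X] [Module A Y] [Module A Z]
  [AddCommGroup X'] [AddCommGroup Y'] [AddCommGroup Z'] [Module A X'] [Module A Y'] [Module A Z']

theorem exact_comp_iff_injective {f : X →ₗ[A] Y} {g : Y →ₗ[A] Z} (hfg : Function.Exact f g)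
    (hg : Function.Surjective g) (i : Z →ₗ[A] Z') :
    Function.Exact f (i ∘ₗ g) ↔ Function.Injective i := by
  refine ⟨fun h => (injective_iff_map_eq_zero i).2 fun z hz => ?_,
    fun h => h.comp_exact_iff_exact.2 hfg⟩
  obtain ⟨y, rfl⟩ := hg z
  exact (hfg y).2 ((h y).1 hz)

theorem bijective_iff_injective_and_exact {f : X →ₗ[A] Y} {g : Y →ₗ[A] Z} {f' : X' →ₗ[A] Y'}
    {g' : Y' →ₗ[A] Z'} {α : X →ₗ[A] X'} {β : Y →ₗ[A] Y'} {γ : Z →ₗ[A] Z'}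
    (hf : f' ∘ₗ α = β ∘ₗ f) (hg : g' ∘ₗ β = γ ∘ₗ g) (hβ : Function.Bijective β)
    (hγ : Function.Injective γ) (hf' : Function.Injective f') (hfg' : Function.Exact f' g') :
    Function.Bijective α ↔ Function.Injective f ∧ Function.Exact f g := by
  have hinj : Function.Injective α ↔ Function.Injective f := by
    rw [← hf'.of_comp_iff α, ← LinearMap.coe_comp, hf, LinearMap.coe_comp, hβ.1.of_comp_iff]
  refine ⟨fun h => ⟨hinj.1 h.1, ?_⟩, fun ⟨hfinj, hfg⟩ => ⟨hinj.2 hfinj, fun x' => ?_⟩⟩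
  · exact (AddMonoidHom.exact_iff_of_surjective_of_bijective_of_injective f.toAddMonoidHom
      g.toAddMonoidHom f'.toAddMonoidHom g'.toAddMonoidHom α.toAddMonoidHom β.toAddMonoidHom
      γ.toAddMonoidHom (congrArg LinearMap.toAddMonoidHom hf)
      (congrArg LinearMap.toAddMonoidHom hg) h.2 hβ hγ).2 hfg'
  · obtain ⟨y, hy⟩ := hβ.2 (f' x')
    obtain ⟨x, rfl⟩ := (hfg y).1 (hγ (by
      rw [← LinearMap.comp_apply, ← hg, LinearMap.comp_apply, hy, hfg'.apply_apply_eq_zero,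
        map_zero]))
    exact ⟨x, hf' ((DFunLike.congr_fun hf x).trans hy)⟩

theorem exact_lcomp (K W : Type*) [Semiring K] [AddCommGroup W] [Module A W] [Module K W]
    [SMulCommClass A K W] {f : X →ₗ[A] Y} {g : Y →ₗ[A] Z} (hfg : Function.Exact f g)
    (hg : Function.Surjective g) :
    Function.Exact (LinearMap.lcomp K W g) (LinearMap.lcomp K W f) := by
  intro h
  constructor
  · intro hh
    have hker : LinearMap.range f ≤ LinearMap.ker h := LinearMap.range_le_ker_iff.2 hh
    exact ⟨(LinearMap.range f).liftQ h hker ∘ₗ (hfg.linearEquivOfSurjective hg).symm.toLinearMap,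
      LinearMap.ext fun x => by simp⟩
  · rintro ⟨k, rfl⟩
    exact LinearMap.ext fun x => by simp [hfg.apply_apply_eq_zero]

theorem exact_lcomp_of_injective {I : Type v} [Small.{v} A] [AddCommGroup I] [Module A I]
    [Module.Injective A I] {f : X →ₗ[A] Y} {g : Y →ₗ[A] Z} (hfg : Function.Exact f g) :
    Function.Exact (LinearMap.lcomp ℤ I g) (LinearMap.lcomp ℤ I f) := by
  have hrange : Function.Exact f g.rangeRestrict := fun y =>
    Subtype.ext_iff.trans (hfg y)
  intro h
  constructor
  · intro hh
    obtain ⟨k, hk⟩ := (exact_lcomp ℤ I hrange g.surjective_rangeRestrict h).1 hh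
    obtain ⟨m, rfl⟩ := Module.Injective.extension_property A I _ _ _
      (LinearMap.range g).injective_subtype k
    exact ⟨m, hk⟩
  · rintro ⟨k, rfl⟩
    exact LinearMap.ext fun x => by simp [hfg.apply_apply_eq_zero]

end Exactness

section Characters

variable {X Y Z : Type*} [AddCommGroup X] [AddCommGroup Y] [AddCommGroup Z]

theorem surjective_compHom'_character_iff {f : X →+ Y} :
    Function.Surjective (AddMonoidHom.compHom' (P := AddCircle (1 : ℚ)) f) ↔
      Function.Injective f :=
  CharacterModule.dual_surjective_iff_injective (f := f.toIntLinearMap)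

theorem bijective_compHom'_character_iff {f : X →+ Y} :
    Function.Bijective (AddMonoidHom.compHom' (P := AddCircle (1 : ℚ)) f) ↔
      Function.Bijective f :=
  CharacterModule.dual_bijective_iff_bijective (f := f.toIntLinearMap)

theorem exists_character_factor {g : X →+ Y} {χ : X →+ AddCircle (1 : ℚ)}
    (hχ : g.ker ≤ χ.ker) : ∃ ψ : Y →+ AddCircle (1 : ℚ), ψ.comp g = χ := by
  obtain ⟨ψ, hψ⟩ := surjective_compHom'_character_iff.2 (QuotientAddGroup.kerLift_injective g)
    (QuotientAddGroup.lift g.ker χ hχ)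
  exact ⟨ψ, AddMonoidHom.ext fun x => DFunLike.congr_fun hψ (x : X ⧸ g.ker)⟩

theorem exact_compHom'_character_iff {f : X →+ Y} {g : Y →+ Z} :
    Function.Exact (AddMonoidHom.compHom' (P := AddCircle (1 : ℚ)) g)
      (AddMonoidHom.compHom' (P := AddCircle (1 : ℚ)) f) ↔ Function.Exact f g := by
  constructor
  · refine fun h => AddMonoidHom.exact_iff.2 (le_antisymm (fun y hy => ?_) ?_)
    · rw [← QuotientAddGroup.eq_zero_iff]
      refine CharacterModule.eq_zero_of_character_apply fun χ => ?_
      obtain ⟨ψ, hψ⟩ := (h (AddMonoidHom.comp χ (QuotientAddGroup.mk' f.range))).1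
        (AddMonoidHom.ext fun x => (congrArg χ ((QuotientAddGroup.eq_zero_iff _).2
          ⟨x, rfl⟩)).trans (map_zero χ))
      exact (DFunLike.congr_fun hψ y).symm.trans
        ((congrArg ψ (g.mem_ker.1 hy)).trans (map_zero ψ))
    · rintro _ ⟨x, rfl⟩
      refine CharacterModule.eq_zero_of_character_apply fun ψ => ?_
      exact DFunLike.congr_fun (h.apply_apply_eq_zero ψ) x
  · refine fun h χ => ⟨fun hχ => exists_character_factor fun y hy => ?_, ?_⟩
    · obtain ⟨x, rfl⟩ := (h y).1 hy
      exact DFunLike.congr_fun hχ x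
    · rintro ⟨ψ, rfl⟩
      exact AddMonoidHom.ext fun x =>
        (congrArg ψ (h.apply_apply_eq_zero x)).trans (map_zero ψ)

end Characters

section TensorDual

variable {R S ω : Type u} [Ring R] [Ring S] [AddCommGroup ω] [Module R ω] [Module Sᵐᵒᵖ ω]
variable {N N' N'' : Type u} [AddCommGroup N] [Module S N] [AddCommGroup N'] [Module S N']
  [AddCommGroup N''] [Module S N'']

theorem Tens.addHom_ext {P : Type*} [AddCommGroup P] {f g : Tens R S ω N →+ P}
    (h : ∀ x y, f (Tens.tmul R S ω x y) = g (Tens.tmul R S ω x y)) : f = g := by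
  refine AddMonoidHom.ext fun t => ?_
  obtain ⟨t, rfl⟩ := (balancing R S ω N).mkQ_surjective t
  exact LinearMap.congr_fun (TensorProduct.ext'
    (g := (f.comp (balancing R S ω N).mkQ.toAddMonoidHom).toIntLinearMap)
    (h := (g.comp (balancing R S ω N).mkQ.toAddMonoidHom).toIntLinearMap) h) t

theorem Tens.surjective_map {g : N →ₗ[S] N'} (hg : Function.Surjective g) :
    Function.Surjective (Tens.map R S ω g) := by
  intro t
  obtain ⟨t, rfl⟩ := (balancing R S ω N').mkQ_surjective t
  obtain ⟨u, rfl⟩ := LinearMap.lTensor_surjective ω (g := g.restrictScalars ℤ) hg t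
  exact ⟨(balancing R S ω N).mkQ u, rfl⟩

variable [SMulCommClass R Sᵐᵒᵖ ω]

theorem balancing_eq_addSubgroupClosure :
    (balancing R S ω N).toAddSubgroup = AddSubgroup.closure
      {t | ∃ (x : ω) (s : S) (y : N), t = (op s • x) ⊗ₜ[ℤ] y - x ⊗ₜ[ℤ] (s • y)} := by
  refine le_antisymm (fun t ht => ?_) ((AddSubgroup.closure_le _).2 Submodule.subset_span)
  induction ht using Submodule.closure_induction with
  | zero => exact zero_mem _
  | add a b _ _ ha hb => exact add_mem ha hb
  | smul_mem r t ht =>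
    obtain ⟨x, s, y, rfl⟩ := ht
    refine AddSubgroup.subset_closure ⟨r • x, s, y, ?_⟩
    rw [smul_sub, TensorProduct.smul_tmul', TensorProduct.smul_tmul', smul_comm r]

/-- The homomorphism out of `ω ⊗_S N` given by a balanced biadditive map. -/
def Tens.liftAdd {P : Type*} [AddCommGroup P] (β : ω →+ N →+ P)
    (hβ : ∀ (x : ω) (s : S) (y : N), β (op s • x) y = β x (s • y)) : Tens R S ω N →+ P :=
  QuotientAddGroup.lift (balancing R S ω N).toAddSubgroup
    (TensorProduct.liftAddHom β fun n x y => by simp) <| by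
      rw [balancing_eq_addSubgroupClosure, AddSubgroup.closure_le]
      rintro _ ⟨x, s, y, rfl⟩
      simp [hβ]

/-- The adjunction isomorphism `(ω ⊗_S N)⁺ ≃ Hom_S(N, ω⁺)`. -/
def tensDual : (Tens R S ω N →+ AddCircle (1 : ℚ)) ≃+ (N →ₗ[S] CharDual ω) where
  toFun χ :=
    { toFun := fun y => (χ.comp
        (LinearMap.toAddMonoidHom (μ R S ω N y : ω →ₗ[R] Tens R S ω N)) : ω →+ AddCircle (1 : ℚ))
      map_add' := fun y y' => CharDual.ext fun x =>
        (congrArg χ (Tens.tmul_add R S ω x y y')).trans (map_add χ _ _)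
      map_smul' := fun s y => CharDual.ext fun x =>
        congrArg χ (Tens.op_smul_tmul R S ω s x y).symm }
  invFun φ := Tens.liftAdd (AddMonoidHom.flip (φ.toAddMonoidHom : N →+ ω →+ _))
    fun x s y => (DFunLike.congr_fun (φ.map_smul s y) x).symm
  left_inv _ := Tens.addHom_ext fun _ _ => rfl
  right_inv _ := rfl
  map_add' _ _ := rfl

theorem Tens.injective_map_iff {g : N →ₗ[S] N'} :
    Function.Injective (Tens.map R S ω g) ↔
      Function.Surjective (LinearMap.lcomp ℤ (CharDual ω) g) := by
  have hcomm : LinearMap.lcomp ℤ (CharDual ω) g ∘ tensDual (R := R) (N := N') =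
      tensDual (R := R) (N := N) ∘ AddMonoidHom.compHom' (Tens.map R S ω g).toAddMonoidHom := rfl
  rw [← (tensDual (R := R)).surjective.of_comp_iff, hcomm, EquivLike.comp_surjective]
  exact surjective_compHom'_character_iff.symm

theorem Tens.exact_map_iff {f : N →ₗ[S] N'} {g : N' →ₗ[S] N''} :
    Function.Exact (Tens.map R S ω f) (Tens.map R S ω g) ↔
      Function.Exact (LinearMap.lcomp ℤ (CharDual ω) g) (LinearMap.lcomp ℤ (CharDual ω) f) := by
  have hladder := Function.Exact.iff_of_ladder_addEquiv
    (e₁ := tensDual) (e₂ := tensDual) (e₃ := tensDual)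
    (f₁₂ := AddMonoidHom.compHom' (Tens.map R S ω g).toAddMonoidHom)
    (f₂₃ := AddMonoidHom.compHom' (Tens.map R S ω f).toAddMonoidHom)
    (g₁₂ := (LinearMap.lcomp ℤ (CharDual ω) g).toAddMonoidHom)
    (g₂₃ := (LinearMap.lcomp ℤ (CharDual ω) f).toAddMonoidHom) rfl rfl
  exact exact_compHom'_character_iff.symm.trans hladder.symm

theorem Tens.exact_map {f : N →ₗ[S] N'} {g : N' →ₗ[S] N''} (hfg : Function.Exact f g)
    (hg : Function.Surjective g) : Function.Exact (Tens.map R S ω f) (Tens.map R S ω g) :=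
  Tens.exact_map_iff.2 (exact_lcomp ℤ (CharDual ω) hfg hg)

end TensorDual

section TorExt

variable {R S ω : Type u} [Ring R] [Ring S] [AddCommGroup ω] [Module R ω] [Module Sᵐᵒᵖ ω]

theorem isZero_tor_succ_iff {N : ModuleCat.{u} S} (P : ProjectiveResolution N) (i : ℕ) :
    Limits.IsZero (Tor R S ω (i + 1) N) ↔
      Function.Exact (Tens.map R S ω (P.complex.d (i + 2) (i + 1)).hom)
        (Tens.map R S ω (P.complex.d (i + 1) i).hom) := by
  rw [Tor, (P.isoLeftDerivedObj (tensorFunctor R S ω) (i + 1)).isZero_iff]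
  change Limits.IsZero
    ((((tensorFunctor R S ω).mapHomologicalComplex _).obj P.complex).homology (i + 1)) ↔ _
  rw [← HomologicalComplex.exactAt_iff_isZero_homology,
    HomologicalComplex.exactAt_iff' _ (i + 2) (i + 1) i (by simp) (by simp),
    ShortComplex.ShortExact.moduleCat_exact_iff_function_exact]
  rfl

theorem subsingleton_ext_succ_iff {A : Type u} [Ring A] {N : ModuleCat.{u} A}
    (P : ProjectiveResolution N) (W : Type u) [AddCommGroup W] [Module A W] (i : ℕ) :
    Subsingleton (Abelian.Ext N (ModuleCat.of A W) (i + 1)) ↔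
      Function.Exact (LinearMap.lcomp ℤ W (P.complex.d (i + 1) i).hom)
        (LinearMap.lcomp ℤ W (P.complex.d (i + 2) (i + 1)).hom) := by
  constructor
  · refine fun h f => ⟨fun hf => ?_, ?_⟩
    · obtain ⟨g, hg⟩ := (P.extMk_eq_zero_iff (ModuleCat.ofHom f) (i + 2) rfl
        (ModuleCat.hom_ext hf) i rfl).1 (Subsingleton.elim _ _)
      exact ⟨g.hom, congrArg ModuleCat.Hom.hom hg⟩
    · rintro ⟨g, rfl⟩
      refine LinearMap.ext fun x => (congrArg g ?_).trans (map_zero g)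
      exact LinearMap.congr_fun (congrArg ModuleCat.Hom.hom (P.complex.d_comp_d _ _ _)) x
  · refine fun h => subsingleton_of_forall_eq 0 fun α => ?_
    obtain ⟨f, hf, rfl⟩ := P.extMk_surjective α (i + 2) rfl
    obtain ⟨g, hg⟩ := (h f.hom).1 (congrArg ModuleCat.Hom.hom hf)
    exact (P.extMk_eq_zero_iff f (i + 2) rfl hf i rfl).2
      ⟨ModuleCat.ofHom g, ModuleCat.hom_ext hg⟩

theorem isZero_tor_succ_iff_subsingleton_ext [SMulCommClass R Sᵐᵒᵖ ω] (N : ModuleCat.{u} S)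
    (i : ℕ) : Limits.IsZero (Tor R S ω (i + 1) N) ↔
      Subsingleton (Abelian.Ext N (ModuleCat.of S (CharDual ω)) (i + 1)) := by
  rw [isZero_tor_succ_iff (projectiveResolution N), Tens.exact_map_iff,
    subsingleton_ext_succ_iff (projectiveResolution N)]

end TorExt

section InjectiveEnvelope

theorem exists_le_maximal_disjoint {α : Type*} [CompleteLattice α] [IsCompactlyGenerated α]
    {a b : α} (h : Disjoint a b) : ∃ c, a ≤ c ∧ Maximal (Disjoint · b) c :=
  zorn_le_nonempty₀ {c | Disjoint c b} (fun c hc hchain _ _ =>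
    ⟨sSup c, hchain.directedOn.disjoint_sSup_left.2 fun _ hx => hc hx, fun _ => le_sSup⟩) a h

theorem eq_bot_of_le_of_maximal_disjoint {α : Type*} [Lattice α] [OrderBot α] [IsModularLattice α]
    {k a e l : α} (hk : Maximal (Disjoint · a) k) (hae : a ≤ e) (hke : Disjoint k e)
    (hle : l ≤ e) (hla : Disjoint l a) : l = ⊥ := by
  have hmod : (l ⊔ k) ⊓ e = l := by rw [sup_inf_assoc_of_le k hle, hke.eq_bot, sup_bot_eq]
  have hdisj : Disjoint (l ⊔ k) a :=
    disjoint_iff_inf_le.2 ((le_inf ((inf_le_inf_left _ hae).trans_eq hmod) inf_le_right).trans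
      hla.eq_bot.le)
  exact le_bot_iff.1 (hke (le_sup_left.trans (hk.2 hdisj le_sup_right)) hle)

variable {A : Type u} [Ring A] {J : Type u} [AddCommGroup J] [Module A J]

theorem isCompl_of_maximal_disjoint [Module.Injective A J] {E K : Submodule A J}
    (hK : Maximal (Disjoint · E) K) (hE : Maximal (Disjoint · K) E) : IsCompl E K := by
  obtain ⟨ψ, hψE, hψK⟩ : ∃ ψ : J →ₗ[A] J, (∀ x ∈ E, ψ x = x) ∧ ∀ x ∈ K, ψ x = 0 := by
    have hinj : Function.Injective (K.mkQ ∘ₗ E.subtype) := by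
      rw [← LinearMap.ker_eq_bot, LinearMap.ker_comp, Submodule.ker_mkQ,
        ← Submodule.disjoint_iff_comap_eq_bot]
      exact hE.1
    obtain ⟨φ, hφ⟩ := Module.Injective.extension_property A _ _ _ _ hinj E.subtype
    refine ⟨φ ∘ₗ K.mkQ, fun x hx => LinearMap.congr_fun hφ ⟨x, hx⟩, fun x hx => ?_⟩
    rw [LinearMap.comp_apply, K.mkQ_apply, (Submodule.Quotient.mk_eq_zero K).2 hx, map_zero]
  have hcomap : K.comap ψ ≤ K := hK.2
    (Submodule.disjoint_def.2 fun x hx hxE =>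
      Submodule.disjoint_def.1 hE.1 x hxE (by rwa [Submodule.mem_comap, hψE x hxE] at hx))
    fun x hx => by simp [hψK x hx]
  have hrange : LinearMap.range ψ ≤ E := by
    refine hE.2 (Submodule.disjoint_def.2 ?_) fun x hx => ⟨x, hψE x hx⟩
    rintro _ ⟨x, rfl⟩ hx
    exact hψK x (hcomap hx)
  refine ⟨hE.1, codisjoint_iff_le_sup.2 fun x _ => ?_⟩
  rw [← add_sub_cancel (ψ x) x]
  have hx : ψ x ∈ E := hrange ⟨x, rfl⟩
  exact Submodule.add_mem_sup hx (hcomap (by simp [hψE _ hx]))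

theorem exists_isCompl_essential [Module.Injective A J] (M : Submodule A J) :
    ∃ E K : Submodule A J, IsCompl E K ∧ M ≤ E ∧ ∀ L ≤ E, Disjoint L M → L = ⊥ := by
  obtain ⟨K, -, hK⟩ := exists_le_maximal_disjoint (disjoint_bot_left (a := M))
  obtain ⟨E, hME, hE⟩ := exists_le_maximal_disjoint hK.1.symm
  have hKE : Maximal (Disjoint · E) K :=
    ⟨hE.1.symm, fun L hL => hK.2 (hL.mono_right hME)⟩
  exact ⟨E, K, isCompl_of_maximal_disjoint hKE hE, hME,
    fun L hLE hLM => eq_bot_of_le_of_maximal_disjoint hK hME hE.1.symm hLE hLM⟩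

theorem injective_of_isCompl [Module.Injective A J] {E K : Submodule A J} (h : IsCompl E K) :
    Injective (ModuleCat.of A E) :=
  have : Injective (ModuleCat.of A J) := Module.injective_object_of_injective_module A J
  Retract.injective (Y := ModuleCat.of A J)
    { i := ModuleCat.ofHom E.subtype
      r := ModuleCat.ofHom (E.projectionOnto K h)
      retract := ModuleCat.hom_ext (Submodule.projectionOnto_comp_subtype h) }

theorem exists_injective_envelope (M : Type u) [AddCommGroup M] [Module A M] :
    ∃ (E : ModuleCat.{u} A) (ε : M →ₗ[A] E), Injective E ∧ Function.Injective ε ∧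
      IsEssential (LinearMap.range ε) := by
  let ι := Injective.ι (ModuleCat.of A M)
  have : Module.Injective A ↑(Injective.under (ModuleCat.of A M)) :=
    (Module.injective_iff_injective_object A _).2 (inferInstanceAs (Injective (Injective.under _)))
  obtain ⟨E, K, hEK, hME, hess⟩ := exists_isCompl_essential (LinearMap.range ι.hom)
  refine ⟨ModuleCat.of A E, ι.hom.codRestrict E fun x => hME ⟨x, rfl⟩, injective_of_isCompl hEK,
    ?_, fun L hL => ?_⟩
  · exact (LinearMap.injective_codRestrict_iff _).2
      ((ModuleCat.mono_iff_injective ι).1 inferInstance)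
  · refine ((Submodule.map_injective_of_injective E.injective_subtype).eq_iff'
      (Submodule.map_bot _)).1 (hess _ (Submodule.map_subtype_le E L) (Submodule.disjoint_def.2 ?_))
    rintro _ ⟨x, hx, rfl⟩ ⟨y, hy⟩
    have hx' : x ∈ L ⊓ LinearMap.range (ι.hom.codRestrict E fun x => hME ⟨x, rfl⟩) :=
      ⟨hx, y, Subtype.ext hy⟩
    rw [hL, Submodule.mem_bot] at hx'
    exact congrArg E.subtype hx'

theorem nonempty_minimalInjectiveCopresentation (M : ModuleCat.{u} A) :
    Nonempty (MinimalInjectiveCopresentation M) := by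
  obtain ⟨I₀, ε, hI₀, hε, hess₀⟩ := exists_injective_envelope (A := A) M
  obtain ⟨I₁, j, hI₁, hj, hess₁⟩ := exists_injective_envelope (A := A) (I₀ ⧸ LinearMap.range ε)
  exact ⟨{
    I₀ := I₀
    I₁ := I₁
    ε := ModuleCat.ofHom ε
    f := ModuleCat.ofHom (j ∘ₗ (LinearMap.range ε).mkQ)
    injective₀ := hI₀
    injective₁ := hI₁
    ε_injective := hε
    exact := hj.comp_exact_iff_exact.2 (LinearMap.exact_map_mkQ_range ε)
    essential₀ := hess₀
    essential₁ := by
      rwa [ModuleCat.hom_ofHom, LinearMap.range_comp, Submodule.range_mkQ, Submodule.map_top] }⟩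

end InjectiveEnvelope

section FinitelyPresented

/-- `X` is a module of type `FP_n`: it has a projective resolution that is finitely generated in
degrees at most `n`. -/
inductive IsFP (A : Type u) [Ring A] : ℕ → ModuleCat.{u} A → Prop
  | zero (X : ModuleCat.{u} A) [Module.Finite A X] : IsFP A 0 X
  | succ {n : ℕ} {T : ShortComplex (ModuleCat.{u} A)} (hT : T.ShortExact) [Projective T.X₂]
      [Module.Finite A T.X₂] (h : IsFP A n T.X₁) : IsFP A (n + 1) T.X₃

variable {A : Type u} [Ring A]

theorem IsFP.finite {n : ℕ} {X : ModuleCat.{u} A} (h : IsFP A n X) : Module.Finite A X := by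
  cases h with
  | zero => assumption
  | succ hT => exact Module.Finite.of_surjective _ hT.moduleCat_surjective_g

theorem IsFP.of_surjective {n : ℕ} {P X : ModuleCat.{u} A} [Projective P] [Module.Finite A P]
    {b : P →ₗ[A] X} (hb : Function.Surjective b)
    (h : IsFP A n (ModuleCat.of A (LinearMap.ker b))) : IsFP A (n + 1) X :=
  have : Projective b.shortComplexKer.X₂ := ‹Projective P›
  have : Module.Finite A b.shortComplexKer.X₂ := ‹Module.Finite A P›
  .succ (LinearMap.shortExact_shortComplexKer hb) h

theorem isFP_range_d {X : ModuleCat.{u} A} (P : ProjectiveResolution X)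
    (hP : ∀ n, Module.Finite A (P.complex.X n)) (n k : ℕ) :
    IsFP A n (ModuleCat.of A (LinearMap.range (P.complex.d (k + 1) k).hom)) := by
  have := hP (k + 1)
  induction n generalizing k with
  | zero => exact .zero _
  | succ n ih =>
    refine .of_surjective (LinearMap.surjective_rangeRestrict _) ?_
    rw [LinearMap.ker_rangeRestrict, ← (P.exact_succ k).moduleCat_range_eq_ker]
    exact ih (k + 1) (hP _)

theorem HasDegreewiseFiniteResolution.isFP {X : Type u} [AddCommGroup X] [Module A X]
    (h : HasDegreewiseFiniteResolution A X) (n : ℕ) : IsFP A (n + 1) (ModuleCat.of A X) := by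
  obtain ⟨P, hP⟩ := h
  have := hP 0
  refine .of_surjective (b := (P.π.f 0).hom) ((ModuleCat.epi_iff_surjective _).1 inferInstance) ?_
  exact P.exact₀.moduleCat_range_eq_ker ▸ isFP_range_d P hP n 0

theorem exists_dual_basis (P : Type*) [AddCommGroup P] [Module A P] [Module.Projective A P]
    [Module.Finite A P] : ∃ (n : ℕ) (p : Fin n → P) (φ : Fin n → P →ₗ[A] A),
      ∀ x, ∑ i, φ i x • p i = x := by
  obtain ⟨n, f, g, _, _, hfg⟩ := Module.Finite.exists_comp_eq_id_of_projective A P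
  refine ⟨n, fun i => f fun j => if i = j then 1 else 0, fun i => LinearMap.proj i ∘ₗ g,
    fun x => ?_⟩
  exact (f.pi_apply_eq_sum_univ (g x)).symm.trans (LinearMap.congr_fun hfg x)

end FinitelyPresented

section CharDualMap

variable {S : Type u} [Ring S] {X Y Z : Type u} [AddCommGroup X] [AddCommGroup Y] [AddCommGroup Z]
  [Module Sᵐᵒᵖ X] [Module Sᵐᵒᵖ Y] [Module Sᵐᵒᵖ Z]

/-- The homomorphism `Y⁺ → X⁺` of left `S`-modules dual to a homomorphism of right modules. -/
def CharDual.map (a : X →ₗ[Sᵐᵒᵖ] Y) : CharDual Y →ₗ[S] CharDual X where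
  toFun := AddMonoidHom.compHom' a.toAddMonoidHom
  map_add' := map_add _
  map_smul' s χ := CharDual.ext fun x => congrArg χ (a.map_smul (op s) x).symm

theorem CharDual.exact_map {a : X →ₗ[Sᵐᵒᵖ] Y} {b : Y →ₗ[Sᵐᵒᵖ] Z} (h : Function.Exact a b) :
    Function.Exact (CharDual.map b) (CharDual.map a) :=
  exact_compHom'_character_iff (f := a.toAddMonoidHom) (g := b.toAddMonoidHom).2 h

theorem CharDual.injective_map {a : X →ₗ[Sᵐᵒᵖ] Y} (ha : Function.Surjective a) :
    Function.Injective (CharDual.map a) :=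
  fun _ _ h => CharDual.ext fun y => by
    obtain ⟨x, rfl⟩ := ha y
    exact DFunLike.congr_fun h x

/-- The complex `X₃⁺ → X₂⁺ → X₁⁺` of left `S`-modules dual to a complex `X₁ → X₂ → X₃` of right
`S`-modules. -/
def CharDual.shortComplex (T : ShortComplex (ModuleCat.{u} Sᵐᵒᵖ)) :
    ShortComplex (ModuleCat.{u} S) :=
  ModuleCat.shortComplexOfCompEqZero (CharDual.map T.g.hom) (CharDual.map T.f.hom) <|
    LinearMap.ext fun χ => CharDual.ext fun x =>
      (congrArg χ (T.moduleCat_zero_apply x)).trans (AddMonoidHom.map_zero (M := T.X₃) χ)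

theorem CharDual.shortExact_shortComplex {T : ShortComplex (ModuleCat.{u} Sᵐᵒᵖ)}
    (hT : T.ShortExact) : (CharDual.shortComplex T).ShortExact :=
  ModuleCat.shortComplex_shortExact _
    (CharDual.exact_map ((ShortComplex.ShortExact.moduleCat_exact_iff_function_exact _).1 hT.exact))
    (CharDual.injective_map hT.moduleCat_surjective_g)
    ((surjective_compHom'_character_iff (f := T.f.hom.toAddMonoidHom)).2
      hT.moduleCat_injective_f)

variable {N N' : Type u} [AddCommGroup N] [Module S N] [AddCommGroup N'] [Module S N']

/-- The homomorphism `N → X⁺`, `n ↦ (x ↦ χ (φ(x) • n))`. For `X = S` and `φ = id` it is the one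
corresponding to `χ` under `Hom_S(N, S⁺) ≃ N⁺`. -/
def CharDual.coextend (φ : X →ₗ[Sᵐᵒᵖ] Sᵐᵒᵖ) (χ : N →+ AddCircle (1 : ℚ)) : N →ₗ[S] CharDual X where
  toFun n := ({
    toFun := fun x => χ (unop (φ x) • n)
    map_zero' := by simp
    map_add' := fun x y => by simp [add_smul] } : X →+ AddCircle (1 : ℚ))
  map_add' n n' := CharDual.ext fun x =>
    (congrArg χ (smul_add (unop (φ x)) n n')).trans (map_add χ _ _)
  map_smul' s n := CharDual.ext fun x => congrArg χ <|
    (smul_smul _ s n).trans (congrArg (unop · • n) (φ.map_smul (op s) x).symm)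

theorem CharDual.coextend_comp (φ : X →ₗ[Sᵐᵒᵖ] Sᵐᵒᵖ) (χ : N' →+ AddCircle (1 : ℚ))
    (j : N →ₗ[S] N') :
    CharDual.coextend φ χ ∘ₗ j = CharDual.coextend φ (χ.comp j.toAddMonoidHom) :=
  LinearMap.ext fun n => CharDual.ext fun x => congrArg χ (j.map_smul (unop (φ x)) n).symm

/-- The character `n ↦ f n x`. -/
def CharDual.evalAt (x : X) (f : N →ₗ[S] CharDual X) : N →+ AddCircle (1 : ℚ) :=
  AddMonoidHom.flip (f.toAddMonoidHom : N →+ X →+ AddCircle (1 : ℚ)) x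

theorem CharDual.sum_coextend_evalAt {n : ℕ} {p : Fin n → X} {φ : Fin n → X →ₗ[Sᵐᵒᵖ] Sᵐᵒᵖ}
    (hφ : ∀ x, ∑ i, φ i x • p i = x) (f : N →ₗ[S] CharDual X) :
    ∑ i, CharDual.coextend (φ i) (CharDual.evalAt (p i) f) = f := by
  refine LinearMap.ext fun y => CharDual.ext fun x => ?_
  let eval : (N →ₗ[S] CharDual X) →+ AddCircle (1 : ℚ) :=
    { toFun := fun k => k y x, map_zero' := rfl, map_add' := fun _ _ => rfl }
  calc eval (∑ i, CharDual.coextend (φ i) (CharDual.evalAt (p i) f))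
      = ∑ i, eval (CharDual.coextend (φ i) (CharDual.evalAt (p i) f)) := map_sum eval _ _
    _ = ∑ i, (show X →+ AddCircle (1 : ℚ) from f y) (φ i x • p i) :=
        Finset.sum_congr rfl fun i _ => DFunLike.congr_fun (f.map_smul (unop (φ i x)) y) (p i)
    _ = f y x := by rw [← map_sum, hφ]; rfl

theorem CharDual.injective [Module.Projective Sᵐᵒᵖ X] [Module.Finite Sᵐᵒᵖ X] :
    Module.Injective S (CharDual X) := by
  obtain ⟨n, p, φ, hφ⟩ := exists_dual_basis (A := Sᵐᵒᵖ) X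
  refine ⟨fun B C _ _ _ _ j hj f => ?_⟩
  choose χ hχ using fun i =>
    (surjective_compHom'_character_iff (f := j.toAddMonoidHom)).2 hj (CharDual.evalAt (p i) f)
  refine ⟨∑ i, CharDual.coextend (φ i) (χ i), LinearMap.congr_fun (f := _ ∘ₗ j) ?_⟩
  calc (∑ i, CharDual.coextend (φ i) (χ i)) ∘ₗ j
      = ∑ i, CharDual.coextend (φ i) ((χ i).comp j.toAddMonoidHom) :=
        (map_sum (LinearMap.lcomp ℤ _ j) _ _).trans
          (Finset.sum_congr rfl fun i _ => CharDual.coextend_comp (φ i) (χ i) j)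
    _ = ∑ i, CharDual.coextend (φ i) (CharDual.evalAt (p i) f) :=
        Finset.sum_congr rfl fun i _ => congrArg _ (hχ i)
    _ = f := CharDual.sum_coextend_evalAt hφ f

end CharDualMap

section Evaluation

variable {R S ω I : Type u} [Ring R] [Ring S] [AddCommGroup ω] [Module R ω] [Module Sᵐᵒᵖ ω]
  [SMulCommClass R Sᵐᵒᵖ ω] [AddCommGroup I] [Module R I]
variable {X Y Z : Type u} [AddCommGroup X] [AddCommGroup Y] [AddCommGroup Z]
  [Module Sᵐᵒᵖ X] [Module Sᵐᵒᵖ Y] [Module Sᵐᵒᵖ Z]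

local instance : SMulCommClass Sᵐᵒᵖ R ω := .symm R Sᵐᵒᵖ ω

variable (R S ω I X) in
/-- `Hom_R(Hom_{Sᵒᵖ}(X, ω), I)`, a covariant functor of the right `S`-module `X` that is right
exact when `I` is injective. -/
abbrev DoubleHom : Type u := (X →ₗ[Sᵐᵒᵖ] ω) →ₗ[R] I

variable (R ω I) in
/-- The homomorphism of double Homs induced by `a : X → Y`. -/
abbrev DoubleHom.map (a : X →ₗ[Sᵐᵒᵖ] Y) : DoubleHom R S ω I X →+ DoubleHom R S ω I Y :=
  (LinearMap.lcomp ℤ I (LinearMap.lcomp R ω a)).toAddMonoidHom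

theorem DoubleHom.exact_map [Module.Injective R I] {a : X →ₗ[Sᵐᵒᵖ] Y} {b : Y →ₗ[Sᵐᵒᵖ] Z}
    (hab : Function.Exact a b) (hb : Function.Surjective b) :
    Function.Exact (DoubleHom.map R ω I a) (DoubleHom.map R ω I b) :=
  exact_lcomp_of_injective (exact_lcomp R ω hab hb)

theorem DoubleHom.surjective_map [Module.Injective R I] {b : Y →ₗ[Sᵐᵒᵖ] Z}
    (hb : Function.Surjective b) : Function.Surjective (DoubleHom.map R ω I b) :=
  Module.Injective.extension_property R I _ _ (LinearMap.lcomp R ω b)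
    (LinearMap.lcomp_injective_of_surjective b hb)

/-- The evaluation homomorphism `x ↦ (g ↦ f (g x))`. -/
def DoubleHom.eval (f : RHom R ω I) : X →+ DoubleHom R S ω I X where
  toFun x := (f : ω →ₗ[R] I) ∘ₗ LinearMap.applyₗ' R x
  map_zero' := by rw [map_zero]; exact LinearMap.comp_zero _
  map_add' x y := by rw [map_add]; exact LinearMap.comp_add _ _ _

/-- The homomorphism `h ↦ (w ↦ h (x ↦ φ x • w))`. When `(p i, φ i)` is a dual basis of `X`, these
are the coordinates of elements of the double Hom with respect to evaluation at the `p i`. -/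
def DoubleHom.coord (φ : X →ₗ[Sᵐᵒᵖ] Sᵐᵒᵖ) : DoubleHom R S ω I X →+ RHom R ω I where
  toFun h := h ∘ₗ
    { toFun := φ.smulRight
      map_add' := fun _ _ => LinearMap.ext fun _ => smul_add _ _ _
      map_smul' := fun r w => LinearMap.ext fun x => (smul_comm r (φ x) w).symm }
  map_zero' := rfl
  map_add' _ _ := rfl

theorem DoubleHom.sum_eval_coord {n : ℕ} {p : Fin n → X} {φ : Fin n → X →ₗ[Sᵐᵒᵖ] Sᵐᵒᵖ}
    (hφ : ∀ x, ∑ i, φ i x • p i = x) (h : DoubleHom R S ω I X) :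
    ∑ i, eval (coord (φ i) h) (p i) = h := by
  refine LinearMap.ext fun g => ?_
  have hg : ∑ i, (φ i).smulRight (g (p i)) = g := LinearMap.ext fun x => by
    conv_rhs => rw [← hφ x]
    simp only [LinearMap.sum_apply, LinearMap.smulRight_apply, map_sum, map_smul]
  calc (∑ i, eval (coord (φ i) h) (p i)) g = ∑ i, h ((φ i).smulRight (g (p i))) :=
        LinearMap.sum_apply _ _ _
    _ = h g := by rw [← map_sum, hg]

/-- The homomorphism `Hom_R(Hom_{Sᵒᵖ}(X, ω), I)⁺ → Hom_S(Hom_R(ω, I), X⁺)` that corresponds to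
the character dual of tensor evaluation `X ⊗_S Hom_R(ω, I) → Hom_R(Hom_{Sᵒᵖ}(X, ω), I)`. -/
def evalDual : (DoubleHom R S ω I X →+ AddCircle (1 : ℚ)) →+ (RHom R ω I →ₗ[S] CharDual X) where
  toFun χ :=
    { toFun := fun f => χ.comp (DoubleHom.eval f)
      map_add' := fun f f' => CharDual.ext fun x =>
        map_add χ (DoubleHom.eval f x) (DoubleHom.eval f' x)
      map_smul' := fun s f => CharDual.ext fun x => congrArg χ <| LinearMap.ext fun g =>
        congrArg f (g.map_smul (op s) x).symm }
  map_zero' := rfl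
  map_add' _ _ := rfl

theorem evalDual_comp_map (a : X →ₗ[Sᵐᵒᵖ] Y) (χ : DoubleHom R S ω I Y →+ AddCircle (1 : ℚ)) :
    evalDual (χ.comp (DoubleHom.map R ω I a)) = CharDual.map a ∘ₗ evalDual χ := rfl

theorem bijective_evalDual_of_projective [Module.Projective Sᵐᵒᵖ X] [Module.Finite Sᵐᵒᵖ X] :
    Function.Bijective (evalDual (R := R) (S := S) (ω := ω) (I := I) (X := X)) := by
  obtain ⟨n, p, φ, hφ⟩ := exists_dual_basis (A := Sᵐᵒᵖ) X
  refine ⟨(injective_iff_map_eq_zero _).2 fun χ hχ => AddMonoidHom.ext fun h => ?_, fun β =>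
    ⟨∑ i, (CharDual.evalAt (p i) β).comp (DoubleHom.coord (φ i)), ?_⟩⟩
  · rw [← DoubleHom.sum_eval_coord hφ h, map_sum]
    exact Finset.sum_eq_zero fun i _ =>
      DFunLike.congr_fun (LinearMap.congr_fun hχ (DoubleHom.coord (φ i) h)) (p i)
  · rw [map_sum]
    exact CharDual.sum_coextend_evalAt hφ β

theorem injective_evalDual [Module.Injective R I] [Module.Finite Sᵐᵒᵖ X] :
    Function.Injective (evalDual (R := R) (S := S) (ω := ω) (I := I) (X := X)) := by
  obtain ⟨n, b, hb⟩ := Module.Finite.exists_fin' Sᵐᵒᵖ X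
  refine (injective_iff_map_eq_zero _).2 fun χ hχ => ?_
  have hcomp : χ.comp (DoubleHom.map R ω I b) = 0 :=
    (injective_iff_map_eq_zero _).1 bijective_evalDual_of_projective.1 _ <| by
      rw [evalDual_comp_map, hχ, LinearMap.comp_zero]
  exact (AddMonoidHom.cancel_right (DoubleHom.surjective_map hb)).1 hcomp

theorem IsFP.surjective_evalDual [Module.Injective R I] {X : ModuleCat.{u} Sᵐᵒᵖ}
    (hX : IsFP Sᵐᵒᵖ 1 X) :
    Function.Surjective (evalDual (R := R) (S := S) (ω := ω) (I := I) (X := X)) := by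
  intro β
  obtain - | @⟨_, T, hT, _, _, hX₁⟩ := hX
  have := hX₁.finite
  have : Module.Projective Sᵐᵒᵖ T.X₂ := (IsProjective.iff_projective _).2 ‹_›
  have hexact := (ShortComplex.ShortExact.moduleCat_exact_iff_function_exact _).1 hT.exact
  obtain ⟨χ, hχ⟩ := bijective_evalDual_of_projective.2 (CharDual.map T.g.hom ∘ₗ β)
  have hcomp : χ.comp (DoubleHom.map R ω I T.f.hom) = 0 :=
    (injective_iff_map_eq_zero _).1 injective_evalDual _ <| by
      rw [evalDual_comp_map, hχ, ← LinearMap.comp_assoc,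
        (CharDual.exact_map hexact).linearMap_comp_eq_zero, LinearMap.zero_comp]
  obtain ⟨ψ, hψ⟩ := (exact_compHom'_character_iff.2
    (DoubleHom.exact_map hexact hT.moduleCat_surjective_g) χ).1 hcomp
  exact ⟨ψ, LinearMap.ext fun f => CharDual.injective_map hT.moduleCat_surjective_g <|
    LinearMap.congr_fun ((evalDual_comp_map T.g.hom ψ).symm.trans
      ((congrArg evalDual hψ).trans hχ)) f⟩

theorem IsFP.subsingleton_ext_charDual [Module.Injective R I] {X : ModuleCat.{u} Sᵐᵒᵖ} (i : ℕ)
    (hX : IsFP Sᵐᵒᵖ (i + 2) X)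
    (hext : ∀ j : ℕ, 1 ≤ j → Subsingleton (Abelian.Ext X (ModuleCat.of Sᵐᵒᵖ ω) j)) :
    Subsingleton (Abelian.Ext (ModuleCat.of S (RHom R ω I)) (ModuleCat.of S (CharDual X))
      (i + 1)) := by
  induction i generalizing X with
  | zero =>
    obtain - | @⟨_, T, hT, _, _, hX₁⟩ := hX
    have : Module.Projective Sᵐᵒᵖ T.X₂ := (IsProjective.iff_projective _).2 ‹_›
    have : Injective (CharDual.shortComplex T).X₂ :=
      (Module.injective_iff_injective_object _ _).1 CharDual.injective
    have hmap : Function.Injective (DoubleHom.map R ω I T.f.hom) :=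
      LinearMap.lcomp_injective_of_surjective (LinearMap.lcomp R ω T.f.hom) fun g => by
        obtain ⟨k, hk⟩ :=
          exists_extension_of_subsingleton_ext hT (hext 1 le_rfl) (ModuleCat.ofHom g)
        exact ⟨k.hom, congrArg ModuleCat.Hom.hom hk⟩
    refine subsingleton_ext_one_of_exists_lift (CharDual.shortExact_shortComplex hT) fun β => ?_
    obtain ⟨χ, hχ⟩ := hX₁.surjective_evalDual (R := R) (ω := ω) (I := I) β.hom
    obtain ⟨ψ, rfl⟩ := surjective_compHom'_character_iff.2 hmap χ
    exact ⟨ModuleCat.ofHom (evalDual ψ), ModuleCat.hom_ext hχ⟩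
  | succ i ih =>
    obtain - | @⟨_, T, hT, _, _, hX₁⟩ := hX
    have : Module.Projective Sᵐᵒᵖ T.X₂ := (IsProjective.iff_projective _).2 ‹_›
    have : Injective (CharDual.shortComplex T).X₂ :=
      (Module.injective_iff_injective_object _ _).1 CharDual.injective
    refine subsingleton_ext_X₁_of_injective (CharDual.shortExact_shortComplex hT)
      (ih hX₁ fun j hj => ?_)
    obtain ⟨j, rfl⟩ := Nat.exists_eq_add_of_le' hj
    exact subsingleton_ext_X₁ hT (Abelian.Ext.subsingleton_of_projective _ _ j)
      (hext _ (by omega))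

end Evaluation

section Adjunction

variable (R S ω : Type u) [Ring R] [Ring S] [AddCommGroup ω] [Module R ω] [Module Sᵐᵒᵖ ω]

section Counit

variable [SMulCommClass R Sᵐᵒᵖ ω] (M : Type u) [AddCommGroup M] [Module R M]

/-- The canonical homomorphism `θ_M : ω ⊗_S Hom_R(ω, M) → M`, `θ_M(x ⊗ f) = f x`. -/
def θ : Tens R S ω (RHom R ω M) →ₗ[R] M :=
  (balancing R S ω (RHom R ω M)).liftQ
    (TensorProduct.AlgebraTensorModule.lift
      { toFun := fun x => AddMonoidHom.toIntLinearMap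
          { toFun := fun f : RHom R ω M => f x, map_zero' := rfl, map_add' := fun _ _ => rfl }
        map_add' := fun x y => LinearMap.ext fun f => LinearMap.map_add (f : ω →ₗ[R] M) x y
        map_smul' := fun r x => LinearMap.ext fun f => LinearMap.map_smul (f : ω →ₗ[R] M) r x }) <|
    Submodule.span_le.2 <| by
      rintro _ ⟨x, s, f, rfl⟩
      exact LinearMap.sub_mem_ker_iff.2 rfl

variable {R S ω M}

theorem θ_comp_map {M' : Type u} [AddCommGroup M'] [Module R M'] (g : M →ₗ[R] M') :
    θ R S ω M' ∘ₗ Tens.map R S ω (RHom.map S g) = g ∘ₗ θ R S ω M :=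
  Tens.hom_ext R S ω fun _ _ => rfl

end Counit

/-- The adjunction between `ω ⊗_S -` and `Hom_R(ω, -)`, with unit `μ` and counit `θ`. -/
def tensorHomAdjunction [SMulCommClass R Sᵐᵒᵖ ω] : tensorFunctor R S ω ⊣ homFunctor R S ω :=
  .mkOfUnitCounit
    { unit := { app := fun N => ModuleCat.ofHom (μ R S ω N) }
      counit :=
        { app := fun M => ModuleCat.ofHom (θ R S ω M)
          naturality := fun _ _ g => ModuleCat.hom_ext (θ_comp_map g.hom) }
      left_triangle := by
        ext N : 2
        exact ModuleCat.hom_ext (Tens.hom_ext R S ω fun _ _ => rfl)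
      right_triangle := rfl }

end Adjunction

section Equivalence

variable {C D : Type*} [Category* C] [Category* D] {F : C ⥤ D} {G : D ⥤ C}

/-- An adjunction restricts to an equivalence between two full subcategories that it maps into each
other and on which its unit and counit are isomorphisms. -/
def restrictedEquivalence (adj : F ⊣ G) {P : ObjectProperty C} {Q : ObjectProperty D}
    (hF : ∀ X : P.FullSubcategory, Q (F.obj X.obj)) (hG : ∀ Y : Q.FullSubcategory, P (G.obj Y.obj))
    (hunit : ∀ X, P X → IsIso (adj.unit.app X)) (hcounit : ∀ Y, Q Y → IsIso (adj.counit.app Y)) :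
    P.FullSubcategory ≌ Q.FullSubcategory where
  functor := Q.lift (P.ι ⋙ F) hF
  inverse := P.lift (Q.ι ⋙ G) hG
  unitIso := NatIso.ofComponents
    (fun X => P.isoMk (@asIso _ _ _ _ (adj.unit.app X.obj) (hunit _ X.property)))
    fun f => P.hom_ext (adj.unit.naturality f.hom)
  counitIso := NatIso.ofComponents
    (fun Y => Q.isoMk (@asIso _ _ _ _ (adj.counit.app Y.obj) (hcounit _ Y.property)))
    fun f => Q.hom_ext (adj.counit.naturality f.hom)
  functor_unitIso_comp X := Q.hom_ext (adj.left_triangle_components X.obj)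

end Equivalence

section StaticAcyclic

variable {R S ω : Type u} [Ring R] [Ring S] [AddCommGroup ω] [Module R ω] [Module Sᵐᵒᵖ ω]
  [SMulCommClass R Sᵐᵒᵖ ω]

variable (R S ω) in
/-- The class of left `R`-modules `M` such that `θ_M` is an isomorphism and
`Ext_S^i(Hom_R(ω, M), ω⁺) = 0` for `i ≥ 1`. By character duality the second condition says that
`Tor_i^S(ω, Hom_R(ω, M)) = 0` for `i ≥ 1`. -/
def staticAcyclic : ObjectProperty (ModuleCat.{u} R) :=
  fun M => Function.Bijective (θ R S ω M) ∧ ∀ i : ℕ, 1 ≤ i →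
    Subsingleton (Abelian.Ext (ModuleCat.of S (RHom R ω M)) (ModuleCat.of S (CharDual ω)) i)

theorem isIso_tensorHomAdjunction_unit_app_iff {N : ModuleCat.{u} S} :
    IsIso ((tensorHomAdjunction R S ω).unit.app N) ↔ IsAdstatic R S ω N :=
  ConcreteCategory.isIso_iff_bijective (ModuleCat.ofHom (μ R S ω N))

theorem isIso_tensorHomAdjunction_counit_app_iff {M : ModuleCat.{u} R} :
    IsIso ((tensorHomAdjunction R S ω).counit.app M) ↔ Function.Bijective (θ R S ω M) :=
  ConcreteCategory.isIso_iff_bijective (ModuleCat.ofHom (θ R S ω M))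

theorem staticAcyclic.homFunctor_obj {M : ModuleCat.{u} R} (hM : staticAcyclic R S ω M) :
    H R S ω ((homFunctor R S ω).obj M) := by
  have := isIso_tensorHomAdjunction_counit_app_iff.2 hM.1
  exact ⟨isIso_tensorHomAdjunction_unit_app_iff.1
    (isIso_of_comp_hom_eq_id _ ((tensorHomAdjunction R S ω).right_triangle_components M)), hM.2⟩

theorem H.staticAcyclic_tensorFunctor_obj {N : ModuleCat.{u} S} (hN : H R S ω N) :
    staticAcyclic R S ω ((tensorFunctor R S ω).obj N) := by
  have := isIso_tensorHomAdjunction_unit_app_iff.2 hN.1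
  refine ⟨isIso_tensorHomAdjunction_counit_app_iff.1
    (isIso_of_hom_comp_eq_id _ ((tensorHomAdjunction R S ω).left_triangle_components N)),
    fun i hi => subsingleton_ext_of_iso ?_ (hN.2 i hi)⟩
  exact (asIso ((tensorHomAdjunction R S ω).unit.app N)).symm

theorem bijective_eval_of_bijective_toSpanSingleton {A Y I : Type*} [Ring A] [AddCommGroup Y]
    [Module A Y] [AddCommGroup I] [Module A I] {y : Y}
    (hy : Function.Bijective (LinearMap.toSpanSingleton A Y y)) :
    Function.Bijective fun f : Y →ₗ[A] I => f y := by
  let e := LinearEquiv.ofBijective _ hy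
  have he : e.symm y = 1 := e.symm_apply_eq.2 (one_smul A y).symm
  refine ⟨fun f g hfg => LinearMap.ext fun z => ?_, fun m =>
    ⟨LinearMap.toSpanSingleton A I m ∘ₗ e.symm.toLinearMap, ?_⟩⟩
  · obtain ⟨a, rfl⟩ := hy.2 z
    rw [LinearMap.toSpanSingleton_apply, map_smul, map_smul]
    exact congrArg (a • ·) hfg
  · exact (congrArg (· • m) he).trans (one_smul A m)

local instance : SMulCommClass Sᵐᵒᵖ R ω := .symm R Sᵐᵒᵖ ω

theorem bijective_θ_of_injective {I : Type u} [AddCommGroup I] [Module R I] [Module.Injective R I]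
    (hfp : IsFP Sᵐᵒᵖ 1 (ModuleCat.of Sᵐᵒᵖ ω))
    (hhom : Function.Bijective fun r : R => leftHomothety S ω r) :
    Function.Bijective (θ R S ω I) := by
  have : Module.Finite Sᵐᵒᵖ ω := hfp.finite
  let evalId : DoubleHom R S ω I ω →+ I :=
    { toFun := fun h => h LinearMap.id, map_zero' := rfl, map_add' := fun _ _ => rfl }
  have hevalId : Function.Bijective (AddMonoidHom.compHom' (P := AddCircle (1 : ℚ)) evalId) :=
    bijective_compHom'_character_iff.2 (bijective_eval_of_bijective_toSpanSingleton hhom)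
  have hcomm : tensDual ∘ AddMonoidHom.compHom' (θ R S ω I).toAddMonoidHom =
      evalDual ∘ AddMonoidHom.compHom' evalId := rfl
  have hcomp : Function.Bijective (tensDual ∘ AddMonoidHom.compHom' (θ R S ω I).toAddMonoidHom) :=
    hcomm.symm ▸ Function.Bijective.comp ⟨injective_evalDual, hfp.surjective_evalDual⟩ hevalId
  exact bijective_compHom'_character_iff.1 ((tensDual.bijective.of_comp_iff' _).1 hcomp)

theorem staticAcyclic_of_injective (hres : HasDegreewiseFiniteResolution Sᵐᵒᵖ ω)
    (hhom : Function.Bijective fun r : R => leftHomothety S ω r)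
    (hext : ∀ i : ℕ, 1 ≤ i →
      Subsingleton (Abelian.Ext (ModuleCat.of Sᵐᵒᵖ ω) (ModuleCat.of Sᵐᵒᵖ ω) i))
    (I : ModuleCat.{u} R) [Injective I] : staticAcyclic R S ω I := by
  have : Module.Injective R I := (Module.injective_iff_injective_object R I).2 ‹_›
  refine ⟨bijective_θ_of_injective (hres.isFP 0) hhom, fun i hi => ?_⟩
  obtain ⟨i, rfl⟩ := Nat.exists_eq_add_of_le' hi
  exact (hres.isFP (i + 1)).subsingleton_ext_charDual i hext

end StaticAcyclic

section Cotorsionfree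

variable {R S ω : Type u} [Ring R] [Ring S] [AddCommGroup ω] [Module R ω] [Module Sᵐᵒᵖ ω]
  [SMulCommClass R Sᵐᵒᵖ ω]
variable {M M' M'' : Type u} [AddCommGroup M] [Module R M] [AddCommGroup M'] [Module R M']
  [AddCommGroup M''] [Module R M'']

theorem RHom.injective_map {g : M →ₗ[R] M'} (hg : Function.Injective g) :
    Function.Injective (RHom.map (ω := ω) S g) :=
  fun _ _ h => RHom.ext fun x => hg (RHom.ext_iff.1 h x)

theorem RHom.exact_map {f : M →ₗ[R] M'} {g : M' →ₗ[R] M''} (hf : Function.Injective f)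
    (hfg : Function.Exact f g) :
    Function.Exact (RHom.map (ω := ω) S f) (RHom.map (ω := ω) S g) := by
  intro k
  constructor
  · intro hk
    have hmem : ∀ x, k x ∈ LinearMap.range f := fun x => (hfg _).1 (RHom.ext_iff.1 hk x)
    let e := LinearEquiv.ofInjective f hf
    exact ⟨e.symm.toLinearMap ∘ₗ LinearMap.codRestrict (LinearMap.range f) (k : ω →ₗ[R] M') hmem,
      RHom.ext fun x => congrArg Subtype.val (e.apply_symm_apply ⟨k x, hmem x⟩)⟩
  · rintro ⟨k, rfl⟩
    exact RHom.ext fun x => hfg.apply_apply_eq_zero (k x)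

theorem RHom.exact_rangeRestrict_map {f : M →ₗ[R] M'} {g : M' →ₗ[R] M''}
    (hf : Function.Injective f) (hfg : Function.Exact f g) :
    Function.Exact (RHom.map (ω := ω) S f) (RHom.map (ω := ω) S g).rangeRestrict :=
  fun k => Subtype.ext_iff.trans (RHom.exact_map hf hfg k)

theorem extVanishesUpTo_succ_iff_injective_map {N N' N'' : Type u} [AddCommGroup N] [Module S N]
    [AddCommGroup N'] [Module S N'] [AddCommGroup N''] [Module S N''] {f : N →ₗ[S] N'}
    {g : N' →ₗ[S] N''} (hf : Function.Injective f) (hfg : Function.Exact f g)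
    (hg : Function.Surjective g) {n : ℕ}
    (h : ExtVanishesUpTo (n + 1) (ModuleCat.of S N') (ModuleCat.of S (CharDual ω))) :
    ExtVanishesUpTo (n + 1) (ModuleCat.of S N'') (ModuleCat.of S (CharDual ω)) ↔
      Function.Injective (Tens.map R S ω f) ∧
        ExtVanishesUpTo n (ModuleCat.of S N) (ModuleCat.of S (CharDual ω)) := by
  rw [Tens.injective_map_iff]
  refine (extVanishesUpTo_succ_iff (ModuleCat.shortComplex_shortExact
    (ModuleCat.shortComplexOfCompEqZero f g hfg.linearMap_comp_eq_zero) hfg hf hg) h).trans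
    (and_congr_left' ?_)
  exact ⟨fun h φ => (h (ModuleCat.ofHom φ)).imp' ModuleCat.Hom.hom fun _ =>
      congrArg ModuleCat.Hom.hom,
    fun h φ => (h φ.hom).imp' ModuleCat.ofHom fun _ => ModuleCat.hom_ext⟩

theorem bijective_θ_iff {f : M →ₗ[R] M'} {g : M' →ₗ[R] M''} (hf : Function.Injective f)
    (hfg : Function.Exact f g) (hM' : Function.Bijective (θ R S ω M'))
    (hM'' : Function.Injective (θ R S ω M'')) :
    Function.Bijective (θ R S ω M) ↔
      Function.Injective (Tens.map R S ω (RHom.map (ω := ω) S f)) ∧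
        Function.Injective (Tens.map R S ω (LinearMap.range (RHom.map (ω := ω) S g)).subtype) := by
  have hsurj := LinearMap.surjective_rangeRestrict (RHom.map (ω := ω) S g)
  have hcomp : Tens.map R S ω (LinearMap.range (RHom.map (ω := ω) S g)).subtype ∘ₗ
      Tens.map R S ω (RHom.map (ω := ω) S g).rangeRestrict =
        Tens.map R S ω (RHom.map (ω := ω) S g) :=
    Tens.hom_ext R S ω fun _ _ => rfl
  have hexact := exact_comp_iff_injective
    (Tens.exact_map (R := R) (ω := ω) (RHom.exact_rangeRestrict_map hf hfg) hsurj)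
    (Tens.surjective_map (R := R) (ω := ω) hsurj)
    (Tens.map R S ω (LinearMap.range (RHom.map (ω := ω) S g)).subtype)
  rw [hcomp] at hexact
  exact (bijective_iff_injective_and_exact (θ_comp_map f).symm (θ_comp_map g).symm
    hM' hM'' hf hfg).trans (and_congr_right' hexact)

theorem forall_isZero_tor_iff_extVanishesUpTo {N : ModuleCat.{u} S} {n : ℕ} :
    (∀ i : ℕ, 1 ≤ i → i ≤ n → Limits.IsZero (Tor R S ω i N)) ↔
      ExtVanishesUpTo n N (ModuleCat.of S (CharDual ω)) := by
  refine forall₃_congr fun i hi _ => ?_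
  obtain ⟨i, rfl⟩ := Nat.exists_eq_add_of_le' hi
  exact isZero_tor_succ_iff_subsingleton_ext N i

theorem forall_isZero_tor_cotranspose_iff {M : ModuleCat.{u} R}
    (P : MinimalInjectiveCopresentation M) (h₀ : staticAcyclic R S ω P.I₀)
    (h₁ : staticAcyclic R S ω P.I₁) (n : ℕ) :
    (∀ i : ℕ, 1 ≤ i → i ≤ n + 2 → Limits.IsZero (Tor R S ω i (cotranspose S ω P))) ↔
      Function.Bijective (θ R S ω M) ∧
        ExtVanishesUpTo n (ModuleCat.of S (RHom R ω M)) (ModuleCat.of S (CharDual ω)) := by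
  have hε : Function.Injective P.ε.hom := P.ε_injective
  have hεf : Function.Exact P.ε.hom P.f.hom := P.exact
  rw [forall_isZero_tor_iff_extVanishesUpTo, cotranspose,
    extVanishesUpTo_succ_iff_injective_map (R := R) (Submodule.injective_subtype _)
      (LinearMap.exact_subtype_mkQ _) (Submodule.mkQ_surjective _) fun i hi _ => h₁.2 i hi,
    extVanishesUpTo_succ_iff_injective_map (R := R) (RHom.injective_map hε)
      (RHom.exact_rangeRestrict_map hε hεf) (LinearMap.surjective_rangeRestrict _)
      fun i hi _ => h₀.2 i hi,
    bijective_θ_iff hε hεf h₀.1 h₁.1.1]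
  tauto

theorem cT_eq_staticAcyclic (h : ∀ (I : ModuleCat.{u} R) [Injective I], staticAcyclic R S ω I) :
    cT R S ω = staticAcyclic R S ω := by
  have hcopres {M : ModuleCat.{u} R} (P : MinimalInjectiveCopresentation M) (n : ℕ) :=
    have := P.injective₀
    have := P.injective₁
    forall_isZero_tor_cotranspose_iff P (h P.I₀) (h P.I₁) n
  ext M
  constructor
  · intro hM
    have hM (n : ℕ) := (hM (n + 2)).elim fun P hP => (hcopres P n).1 hP
    exact ⟨(hM 0).1, fun i hi => (hM i).2 i hi le_rfl⟩
  · obtain ⟨P⟩ := nonempty_minimalInjectiveCopresentation M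
    exact fun hM n => ⟨P, fun i hi hin =>
      (hcopres P n).2 ⟨hM.1, fun j hj _ => hM.2 j hj⟩ i hi (by omega)⟩

end Cotorsionfree

end

end Semidualizing

open Semidualizing in
theorem theorem3p3_general (R S ω : Type u) [Ring R] [Ring S] [AddCommGroup ω] [Module R ω]
    [Module Sᵐᵒᵖ ω] [SMulCommClass R Sᵐᵒᵖ ω] (hres : HasDegreewiseFiniteResolution Sᵐᵒᵖ ω)
    (hhom : Function.Bijective fun r : R => leftHomothety S ω r)
    (hext : ∀ i : ℕ, 1 ≤ i →
      Subsingleton (Abelian.Ext (ModuleCat.of Sᵐᵒᵖ ω) (ModuleCat.of Sᵐᵒᵖ ω) i)) :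
    ∃ (hF : ∀ M : (cT R S ω).FullSubcategory, H R S ω ((homFunctor R S ω).obj M.obj))
      (hG : ∀ N : (H R S ω).FullSubcategory, cT R S ω ((tensorFunctor R S ω).obj N.obj))
      (e : (cT R S ω).FullSubcategory ≌ (H R S ω).FullSubcategory),
      e.functor = (H R S ω).lift ((cT R S ω).ι ⋙ homFunctor R S ω) hF ∧
      e.inverse = (cT R S ω).lift ((H R S ω).ι ⋙ tensorFunctor R S ω) hG := by
  rw [cT_eq_staticAcyclic (staticAcyclic_of_injective hres hhom hext)]
  have hF (M : (staticAcyclic R S ω).FullSubcategory) := M.property.homFunctor_obj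
  have hG (N : (H R S ω).FullSubcategory) := N.property.staticAcyclic_tensorFunctor_obj
  exact ⟨hF, hG, (restrictedEquivalence (tensorHomAdjunction R S ω) hG hF
    (fun _ hN => isIso_tensorHomAdjunction_unit_app_iff.2 hN.1)
    (fun _ hM => isIso_tensorHomAdjunction_counit_app_iff.2 hM.1)).symm, rfl, rfl⟩

open Semidualizing in
theorem theorem3p3 (R S ω : Type u) [Ring R] [Ring S] [AddCommGroup ω] [Module R ω]
    [Module Sᵐᵒᵖ ω] [SMulCommClass R Sᵐᵒᵖ ω] (hω : IsSemidualizing R S ω) :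
    ∃ (hF : ∀ M : (cT R S ω).FullSubcategory, H R S ω ((homFunctor R S ω).obj M.obj))
      (hG : ∀ N : (H R S ω).FullSubcategory, cT R S ω ((tensorFunctor R S ω).obj N.obj))
      (e : (cT R S ω).FullSubcategory ≌ (H R S ω).FullSubcategory),
      e.functor = (H R S ω).lift ((cT R S ω).ι ⋙ homFunctor R S ω) hF ∧
      e.inverse = (cT R S ω).lift ((H R S ω).ι ⋙ tensorFunctor R S ω) hG :=
  theorem3p3_general R S ω hω.finite_right hω.homothety_left hω.ext_right
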